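/- Let $K$ be a finite field of characteristic $p$, let $G$ be a finite group, and let $KG$ be the group algebra. Let $f_0$ be the unique primitive idempotent of the center of $KG$ that acts as the identity on the trivial $KG$-module $K$, and let $B_0(G)=f_0KG$ be the principal $p$-block of $G$, an algebra with identity $f_0$. A right ideal $I$ of an algebra $A$ is called checkable if there is an element $v\in A$ with $I=\{a\in A \mid va=0\}$. Then the following are equivalent. (a) All right ideals of the algebra $B_0(G)$ are checkable (in $B_0(G)$). (b) $G$ is $p$-nilpotent, i.e. $G$ has a normal subgroup $N$ of order prime to $p$ such that $G/N$ is a $p$-group, and $G$ has a cyclic Sylow $p$-subgroup. -/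

import Mathlib

open MulOpposite

/-- The right annihilator `ann_r(C) = {a | c * a = 0 for all c ∈ C}`, as a right ideal.
Right ideals of a ring `A` are the submodules of `A` over the opposite ring `Aᵐᵒᵖ`. -/
def rightAnnihilator {A : Type*} [Ring A] (C : Set A) : Submodule Aᵐᵒᵖ A where
  carrier := {a | ∀ c ∈ C, c * a = 0}
  add_mem' := by
    intro a b ha hb c hc
    rw [mul_add, ha c hc, hb c hc, add_zero]
  zero_mem' := fun c _ => mul_zero c
  smul_mem' := by
    intro r a ha c hc
    rw [← op_unop r, op_smul_eq_mul, ← mul_assoc, ha c hc, zero_mul]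

/-- A right ideal `I` of `A` is checkable if `I = {a ∈ A | v * a = 0}` for some `v ∈ A`. -/
def IsCheckable {A : Type*} [Ring A] (I : Submodule Aᵐᵒᵖ A) : Prop :=
  ∃ v : A, I = rightAnnihilator {v}

/-- A block idempotent of `A`: a primitive idempotent of the center of `A`, that is, a nonzero
central idempotent that is not a sum of two nonzero orthogonal central idempotents. -/
structure IsBlockIdempotent {A : Type*} [Ring A] (f : A) : Prop where
  mem_center : f ∈ Subring.center A
  idem : IsIdempotentElem f
  ne_zero : f ≠ 0
  primitive : ∀ e₁ ∈ Subring.center A, ∀ e₂ ∈ Subring.center A,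
    IsIdempotentElem e₁ → IsIdempotentElem e₂ → e₁ * e₂ = 0 → f = e₁ + e₂ → e₁ = 0 ∨ e₂ = 0

/-- A representation of `G` belongs to the block of `K[G]` with block idempotent `f` if `f` acts on
it as the identity. -/
def BelongsToBlock {K G V : Type*} [Field K] [Group G] [AddCommGroup V] [Module K V]
    (ρ : Representation K G V) (f : MonoidAlgebra K G) : Prop :=
  ρ.asAlgebraHom f = 1

/-- Exactly one block of `K[G]` contains the trivial module. -/
theorem existsUnique_principalBlockIdempotent (K G : Type*) [Field K] [Finite K] [Group G]
    [Finite G] :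
    ∃! f : MonoidAlgebra K G,
      IsBlockIdempotent f ∧ BelongsToBlock (Representation.trivial K G K) f := by
  classical
  have hfin : Finite (MonoidAlgebra K G) := by
    have h : Finite (G →₀ K) := Finite.of_injective _ DFunLike.coe_injective
    exact Finite.of_equiv _ MonoidAlgebra.coeffEquiv.symm
  let Z := Subring.center (MonoidAlgebra K G)
  have hZ : Fintype Z := Fintype.ofFinite _
  let φ := (Representation.trivial K G K).asAlgebraHom
  let S : Finset Z := Finset.univ.filter fun z => z * z = z ∧ φ z = 1
  let z₀ : Z := ∏ z ∈ S, z
  have hidem : z₀ * z₀ = z₀ := by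
    change (∏ z ∈ S, z) * (∏ z ∈ S, z) = ∏ z ∈ S, z
    rw [← Finset.prod_mul_distrib]
    exact Finset.prod_congr rfl fun z hz => (Finset.mem_filter.1 hz).2.1
  have hφ : φ z₀ = 1 := by
    refine Finset.prod_induction (fun z : Z => z) (fun z : Z => φ z = 1) ?_ ?_ ?_
    · intro a b ha hb
      rw [Subring.coe_mul, map_mul, ha, hb, one_mul]
    · exact map_one φ
    · exact fun z hz => (Finset.mem_filter.1 hz).2.2
  have habs : ∀ z : Z, z * z = z → φ z = 1 → z₀ * z = z₀ := by
    intro z h1 h2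
    have hz : z ∈ S := Finset.mem_filter.2 ⟨Finset.mem_univ _, h1, h2⟩
    change (∏ z ∈ S, z) * z = ∏ z ∈ S, z
    rw [← Finset.mul_prod_erase S _ hz, mul_right_comm, h1]
  -- a central idempotent acts on the trivial module as `0` or as `1`
  have hdich : ∀ z : MonoidAlgebra K G, z * z = z → φ z = 0 ∨ φ z = 1 := by
    intro z h1
    have h2 : φ z * φ z = φ z := by rw [← map_mul, h1]
    have h3 : φ z 1 * φ z 1 = φ z 1 := by
      have h4 := LinearMap.congr_fun h2 1
      rw [Module.End.mul_apply] at h4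
      conv_rhs at h4 => rw [← h4]
      have h5 := (φ z).map_smul (φ z 1) 1
      rw [smul_eq_mul, mul_one, smul_eq_mul] at h5
      rw [← h5, h4]
      exact LinearMap.congr_fun h2 1
    have h6 : φ z 1 * (φ z 1 - 1) = 0 := by rw [mul_sub, h3, mul_one, sub_self]
    rcases mul_eq_zero.1 h6 with h | h
    · left
      exact LinearMap.ext_ring h
    · right
      exact LinearMap.ext_ring (sub_eq_zero.1 h)
  have h01 : (1 : Module.End K K) ≠ 0 := one_ne_zero
  refine ⟨z₀, ⟨⟨z₀.2, congrArg Subtype.val hidem, ?_, ?_⟩, hφ⟩, ?_⟩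
  · intro h
    rw [h, map_zero] at hφ
    exact h01 hφ.symm
  · intro e₁ hc₁ e₂ hc₂ hi₁ hi₂ ho hs
    have key : ∀ a b : MonoidAlgebra K G, a ∈ Z → IsIdempotentElem a → a * b = 0 → b * a = 0 →
        (z₀ : MonoidAlgebra K G) = a + b → φ a = 1 → b = 0 := by
      intro a b ha hia _ hba hab h1
      have h2 := congrArg Subtype.val (habs ⟨a, ha⟩ (Subtype.ext hia) h1)
      rw [Subring.coe_mul] at h2
      simp only [hab, add_mul, hia.eq, hba, add_zero] at h2
      exact left_eq_add.1 h2
    have ho' : e₂ * e₁ = 0 := by rw [← Subring.mem_center_iff.1 hc₂ e₁, ho]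
    rcases hdich e₁ hi₁ with h | h
    · left
      refine key e₂ e₁ hc₂ hi₂ ho' ho (by rw [hs, add_comm]) ?_
      rw [hs, map_add, h, zero_add] at hφ
      exact hφ
    · right
      exact key e₁ e₂ hc₁ hi₁ ho ho' hs h
  · rintro f ⟨hf, hf1⟩
    let z : Z := ⟨f, hf.mem_center⟩
    have hzz : z * z = z := Subtype.ext hf.idem
    have h1 : z₀ * z = z₀ := habs z hzz hf1
    have h2 : (z₀ : MonoidAlgebra K G) ≠ 0 := by
      intro h
      rw [h, map_zero] at hφ
      exact h01 hφ.symm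
    have h3 : z₀ * (z - z₀) = 0 := by rw [mul_sub, h1, hidem, sub_self]
    have h4 : (z - z₀) * (z - z₀) = z - z₀ := by
      rw [sub_mul, h3, sub_zero, mul_sub, hzz, mul_comm z z₀, h1]
    rcases hf.primitive z₀ z₀.2 (z - z₀ : Z) (z - z₀).2 (congrArg Subtype.val hidem)
      (congrArg Subtype.val h4) (congrArg Subtype.val h3)
      (by rw [← Subring.coe_add, add_sub_cancel]) with h | h
    · exact absurd h h2
    · exact congrArg Subtype.val (sub_eq_zero.1 (Subtype.ext h : z - z₀ = 0))

/-- The block idempotent `f₀` of the principal block of `K[G]`. -/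
noncomputable def principalBlockIdempotent (K G : Type*) [Field K] [Finite K] [Group G]
    [Finite G] : MonoidAlgebra K G :=
  (existsUnique_principalBlockIdempotent K G).choose

theorem principalBlockIdempotent_spec (K G : Type*) [Field K] [Finite K] [Group G] [Finite G] :
    IsBlockIdempotent (principalBlockIdempotent K G) ∧
      BelongsToBlock (Representation.trivial K G K) (principalBlockIdempotent K G) :=
  (existsUnique_principalBlockIdempotent K G).choose_spec.1

/-- The principal block `B₀(G) = f₀ K[G]`, a ring with identity `f₀`. As `f₀` is central,
`f₀ K[G] = f₀ K[G] f₀`, which is the corner ring of `f₀`. -/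
abbrev PrincipalBlock (K G : Type*) [Field K] [Finite K] [Group G] [Finite G] : Type _ :=
  (principalBlockIdempotent_spec K G).1.idem.Corner

/-- A finite group is `p`-nilpotent if it has a normal `p`-complement: a normal subgroup of order
prime to `p` whose quotient is a `p`-group. -/
def IsPNilpotent (p : ℕ) (G : Type*) [Group G] : Prop :=
  ∃ (N : Subgroup G) (_ : N.Normal), ¬ p ∣ Nat.card N ∧ IsPGroup p (G ⧸ N)

/-! Both directions pass through one property of the block `B`: its augmentation ideal `J` equals
`vB` for some nilpotent `v`.

From checkability, only one right ideal is needed: the line of the norm element, equal to `{a | va =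
0}` for some `v`. Since `v` kills the norm element, `v` lies in `J`, and counting elements gives `vB
= J`. The left annihilator of `J` lies in the same line, so counting again gives `Bv = J`
(`ker_eq_mul_of_rightAnnihilator`). Hence an idempotent power of `v` is central, and the block has
only trivial central idempotents, so `v` is nilpotent (`isNilpotent_of_normalizing`). Now `B = K +
vB` is commutative (`mul_comm_of_center_add_nilpotent`). The kernel `N` of `G → Bˣ` is a `p'`-group,
and `G ⧸ N` is an abelian `p`-group. The image of `v` bounds the dimension of `K[G ⧸ N]` by the
exponent of `G ⧸ N`, which is therefore cyclic; Sylow `p`-subgroups embed in it.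

Conversely, a normal `p`-complement `N` gives `B ≅ K[G ⧸ N]`. If `g` generates the cyclic `p`-group
`G ⧸ N`, then `g - 1` is nilpotent and every nonunit is a multiple of it, so every right ideal is
generated by a power of `g - 1` and is the annihilator of the complementary power. -/

/-! ### Rings whose nonunits or augmentation kernel are governed by one nilpotent element. -/

theorem exists_pow_isIdempotentElem {M : Type*} [Monoid M] [Finite M] (v : M) :
    ∃ n ≠ 0, IsIdempotentElem (v ^ n) := by
  obtain ⟨i, j, hij, h⟩ := Finite.exists_ne_map_eq_of_infinite (fun n : ℕ => v ^ n)
  wlog hlt : i < j generalizing i j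
  · exact this j i hij.symm h.symm (by omega)
  obtain ⟨r, rfl⟩ := Nat.exists_eq_add_of_lt hlt
  have hper : ∀ k m, i ≤ m → v ^ (m + k * (r + 1)) = v ^ m := by
    intro k m hm
    induction k with
    | zero => simp
    | succ k ih =>
      obtain ⟨s, rfl⟩ := Nat.exists_eq_add_of_le hm
      rw [← ih, show i + s + (k + 1) * (r + 1) = i + r + 1 + (s + k * (r + 1)) by ring, pow_add,
        ← h, ← pow_add, add_assoc]
  -- A multiple of the period `r + 1` beyond the preperiod `i`; the factor `i + 1` instead of `i`
  -- keeps it nonzero.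
  refine ⟨(i + 1) * (r + 1), by positivity, ?_⟩
  rw [IsIdempotentElem, ← pow_add]
  exact hper _ _ (by nlinarith)

/-- In a finite ring without nontrivial central idempotents, a nonunit `v` with `vA = Av` is
nilpotent. -/
theorem isNilpotent_of_normalizing {A : Type*} [Ring A] [Finite A]
    (hA : ∀ e ∈ Subring.center A, IsIdempotentElem e → e = 0 ∨ e = 1) {v : A}
    (hl : ∀ a, ∃ b, v * a = b * v) (hr : ∀ a, ∃ b, a * v = v * b) (hv : ¬ IsUnit v) :
    IsNilpotent v := by
  obtain ⟨n, hn, he⟩ := exists_pow_isIdempotentElem v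
  have hl' : ∀ n a, ∃ b, v ^ n * a = b * v ^ n := by
    intro n
    induction n with
    | zero => exact fun a => ⟨a, by simp⟩
    | succ n ih =>
      intro a
      obtain ⟨b, hb⟩ := hl a
      obtain ⟨c, hc⟩ := ih b
      exact ⟨c, by rw [pow_succ, mul_assoc, hb, ← mul_assoc, hc, mul_assoc]⟩
  have hr' : ∀ n a, ∃ b, a * v ^ n = v ^ n * b := by
    intro n
    induction n with
    | zero => exact fun a => ⟨a, by simp⟩
    | succ n ih =>
      intro a
      obtain ⟨b, hb⟩ := hr a
      obtain ⟨c, hc⟩ := ih b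
      exact ⟨c, by rw [pow_succ', ← mul_assoc, hb, mul_assoc, hc, mul_assoc]⟩
  have hc : v ^ n ∈ Subring.center A := by
    rw [Subring.mem_center_iff]
    intro a
    obtain ⟨b, hb⟩ := hl' n a
    obtain ⟨c, hc⟩ := hr' n a
    -- With `e = v ^ n`, both `ea` and `ae` equal `eae`.
    have h1 : v ^ n * a * v ^ n = v ^ n * a := by rw [hb, mul_assoc, he.eq]
    have h2 : v ^ n * a * v ^ n = a * v ^ n := by rw [mul_assoc, hc, ← mul_assoc, he.eq]
    rw [← h1, h2]
  rcases hA _ hc he with h | h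
  · exact ⟨n, h⟩
  · exact absurd (IsUnit.of_pow_eq_one h hn) hv

/-- Substituting the decomposition of `b` into `s + v ^ n * b` pushes the error term one power of
`v` further. -/
theorem exists_eq_add_pow_mul {A : Type*} [Ring A] {S : Subring A} {v : A} (hv : v ∈ S)
    (h : ∀ a, ∃ s ∈ S, ∃ b, a = s + v * b) (n : ℕ) (a : A) :
    ∃ s ∈ S, ∃ b, a = s + v ^ n * b := by
  induction n with
  | zero => exact ⟨0, S.zero_mem, a, by simp⟩
  | succ n ih =>
    obtain ⟨s, hs, b, rfl⟩ := ih
    obtain ⟨t, ht, c, rfl⟩ := h b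
    exact ⟨s + v ^ n * t, S.add_mem hs (S.mul_mem (S.pow_mem hv n) ht), c, by
      rw [pow_succ]; noncomm_ring⟩

theorem subring_eq_top_of_isNilpotent {A : Type*} [Ring A] {S : Subring A} {v : A} (hv : v ∈ S)
    (h : ∀ a, ∃ s ∈ S, ∃ b, a = s + v * b) (hn : IsNilpotent v) : S = ⊤ := by
  obtain ⟨n, hn⟩ := hn
  refine eq_top_iff.2 fun a _ => ?_
  obtain ⟨s, hs, b, rfl⟩ := exists_eq_add_pow_mul hv h n a
  simpa [hn] using hs

/-- The approximation argument is used twice: the centralizer of `v` contains the center and `v`, so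
it is everything; then the center itself contains `v`, so it is everything too. -/
theorem mul_comm_of_center_add_nilpotent {A : Type*} [Ring A] {v : A} (hn : IsNilpotent v)
    (h : ∀ a, ∃ s ∈ Subring.center A, ∃ b, a = s + v * b) (a b : A) : a * b = b * a := by
  have h1 : Subring.centralizer {v} = ⊤ := by
    refine subring_eq_top_of_isNilpotent (v := v) ?_ (fun a => ?_) hn
    · simp [Subring.mem_centralizer_iff]
    · obtain ⟨s, hs, b, hb⟩ := h a
      exact ⟨s, Subring.center_le_centralizer _ hs, b, hb⟩
  have hv : v ∈ Subring.center A := by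
    rw [Subring.mem_center_iff]
    intro g
    have hg : g ∈ Subring.centralizer {v} := h1 ▸ Subring.mem_top g
    exact (Subring.mem_centralizer_iff.1 hg v rfl).symm
  have hb : b ∈ Subring.center A := by
    rw [subring_eq_top_of_isNilpotent hv h hn]
    trivial
  exact Subring.mem_center_iff.1 hb a

/-- A ring in which all nonunits are right multiples of one nilpotent element has only
checkable right ideals. -/
theorem isCheckable_of_isUnit_or_dvd {A : Type*} [Ring A] {v : A}
    (hv : IsNilpotent v) (h : ∀ a, IsUnit a ∨ ∃ b, a = v * b) (I : Submodule Aᵐᵒᵖ A) :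
    IsCheckable I := by
  classical
  have hmul : ∀ a ∈ I, ∀ b, a * b ∈ I := fun a ha b => by
    simpa using I.smul_mem (op b) ha
  have hpow : ∀ a : A, a ≠ 0 → ∃ j u, IsUnit u ∧ a = v ^ j * u := by
    intro a ha
    by_contra! hcon
    have hd : ∀ n, ∃ b, a = v ^ n * b := by
      intro n
      induction n with
      | zero => exact ⟨a, by simp⟩
      | succ n ih =>
        obtain ⟨b, hb⟩ := ih
        rcases h b with hu | ⟨c, rfl⟩
        · exact absurd hb (hcon n b hu)
        · exact ⟨c, by rw [hb, pow_succ, mul_assoc]⟩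
    obtain ⟨n, hn⟩ := hv
    obtain ⟨b, hb⟩ := hd n
    exact ha (by rw [hb, hn, zero_mul])
  have hd : ∃ n, v ^ n = 0 := hv
  have hk : ∃ n, v ^ n ∈ I := hd.imp fun n (hn : v ^ n = 0) => hn ▸ I.zero_mem
  obtain ⟨d, hd0, hdmin⟩ : ∃ d, v ^ d = 0 ∧ ∀ m, v ^ m = 0 → d ≤ m :=
    ⟨Nat.find hd, Nat.find_spec hd, fun m => Nat.find_min' hd⟩
  obtain ⟨k, hk0, hkmin⟩ : ∃ k, v ^ k ∈ I ∧ ∀ m, v ^ m ∈ I → k ≤ m :=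
    ⟨Nat.find hk, Nat.find_spec hk, fun m => Nat.find_min' hk⟩
  have hkd : k ≤ d := hkmin d (hd0 ▸ I.zero_mem)
  -- Nonzero elements are `v ^ j * u` with `u` a unit, so lying in `I` means `k ≤ j`, and being
  -- killed by `v ^ (d - k)` means `d ≤ d - k + j`.
  refine ⟨v ^ (d - k), Submodule.ext fun a => ?_⟩
  change _ ↔ ∀ c ∈ ({v ^ (d - k)} : Set A), c * a = 0
  simp only [Set.mem_singleton_iff, forall_eq]
  by_cases ha : a = 0
  · simp [ha]
  obtain ⟨j, u, hu, rfl⟩ := hpow a ha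
  have h2 : v ^ (d - k) * (v ^ j * u) = 0 ↔ v ^ (d - k + j) = 0 := by
    rw [← mul_assoc, ← pow_add, hu.mul_left_eq_zero]
  rw [h2]
  constructor
  · intro hm
    obtain ⟨w, rfl⟩ := hu
    have := hkmin j (by simpa [mul_assoc] using hmul _ hm (↑w⁻¹))
    exact pow_eq_zero_of_le (by omega) hd0
  · intro h0
    have := hdmin _ h0
    obtain ⟨i, rfl⟩ := Nat.exists_eq_add_of_le (show k ≤ j by omega)
    rw [pow_add, mul_assoc]
    exact hmul _ hk0 _

theorem range_eq_ker_of_card_ker_le {A K : Type*} [AddGroup A] [Finite A] [AddGroup K]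
    (φ : A →+ A) (ε : A →+ K) (hε : Function.Surjective ε) (hle : φ.range ≤ ε.ker)
    (hcard : Nat.card φ.ker ≤ Nat.card K) : φ.range = ε.ker := by
  have hK : Finite K := Finite.of_surjective ε hε
  have h1 : Nat.card φ.ker * Nat.card φ.range = Nat.card A := by
    rw [← AddSubgroup.index_ker, AddSubgroup.card_mul_index]
  have h2 : Nat.card ε.ker * Nat.card K = Nat.card A := by
    rw [← AddSubgroup.card_mul_index ε.ker, AddSubgroup.index_ker,
      AddMonoidHom.range_eq_top.2 hε, AddSubgroup.card_top]
  refine AddSubgroup.eq_of_le_of_card_ge hle ?_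
  have h3 : 0 < Nat.card K := Nat.card_pos
  have h4 : Nat.card ε.ker * Nat.card K ≤ Nat.card φ.range * Nat.card K := by
    rw [h2, ← h1, mul_comm]
    exact Nat.mul_le_mul_left _ hcard
  exact Nat.le_of_mul_le_mul_right h4 h3

/-- If the right annihilator of `v` has the size of `K` and contains the left annihilator of the
kernel of `ε : A → K`, then the kernel is generated by `v` on either side. -/
theorem ker_eq_mul_of_rightAnnihilator {A K : Type*} [Ring A] [Finite A] [Field K] (ε : A →+* K)
    (hε : Function.Surjective ε) {v : A} (hv : ε v = 0)
    (hcard : Nat.card {a : A | v * a = 0} ≤ Nat.card K)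
    (hann : ∀ a : A, (∀ b, ε b = 0 → a * b = 0) → v * a = 0) {a : A} (ha : ε a = 0) :
    (∃ b, a = v * b) ∧ ∃ b, a = b * v := by
  have h1 : (AddMonoidHom.mulLeft v).range = (ε : A →+ K).ker := by
    refine range_eq_ker_of_card_ker_le _ _ hε ?_ hcard
    rintro _ ⟨b, rfl⟩
    simp [AddMonoidHom.mem_ker, hv]
  have key : ∀ a, ε a = 0 → ∃ b, a = v * b := by
    intro a ha
    have : a ∈ (AddMonoidHom.mulLeft v).range := h1 ▸ (by simpa [AddMonoidHom.mem_ker] using ha)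
    obtain ⟨b, rfl⟩ := this
    exact ⟨b, rfl⟩
  have h2 : (AddMonoidHom.mulRight v).range = (ε : A →+ K).ker := by
    refine range_eq_ker_of_card_ker_le _ _ hε ?_ (le_trans ?_ hcard)
    · rintro _ ⟨b, rfl⟩
      simp [AddMonoidHom.mem_ker, hv]
    -- If `a * v = 0`, then `a` kills `vA`, which is the kernel of `ε`; so `hann` puts the left
    -- annihilator of `v` inside the right one.
    · refine Nat.card_mono (Set.toFinite _) fun a ha => hann a fun b hb => ?_
      obtain ⟨c, rfl⟩ := key b hb
      have ha : a * v = 0 := ha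
      rw [← mul_assoc, ha, zero_mul]
  refine ⟨key a ha, ?_⟩
  have : a ∈ (AddMonoidHom.mulRight v).range := h2 ▸ (by simpa [AddMonoidHom.mem_ker] using ha)
  obtain ⟨b, rfl⟩ := this
  exact ⟨b, rfl⟩

/-- An algebra generated by `v` with `v ^ n = 0` has dimension at most `n`. -/
theorem finrank_le_of_pow_eq_zero {K A : Type*} [Field K] [Ring A] [Algebra K A] {v : A} {n : ℕ}
    (hn : v ^ n = 0) (h : ∀ a, ∃ (c : K) (b : A), a = algebraMap K A c + v * b) :
    Module.finrank K A ≤ n := by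
  classical
  have key : ∀ m a, ∃ s ∈ Submodule.span K ((Finset.range m).image (v ^ ·) : Set A), ∃ b,
      a = s + v ^ m * b := by
    intro m
    induction m with
    | zero => exact fun a => ⟨0, Submodule.zero_mem _, a, by simp⟩
    | succ m ih =>
      intro a
      obtain ⟨s, hs, b, rfl⟩ := ih a
      obtain ⟨c, d, rfl⟩ := h b
      refine ⟨s + c • v ^ m, Submodule.add_mem _ ?_ (Submodule.smul_mem _ _ ?_), d, ?_⟩
      · refine Submodule.span_mono ?_ hs
        exact_mod_cast Finset.image_subset_image (Finset.range_mono m.le_succ)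
      · refine Submodule.subset_span ?_
        exact_mod_cast Finset.mem_image_of_mem (v ^ ·) (Finset.self_mem_range_succ m)
      · rw [mul_add, ← Algebra.commutes, ← Algebra.smul_def, pow_succ, mul_assoc, add_assoc]
  have htop : Submodule.span K ((Finset.range n).image (v ^ ·) : Set A) = ⊤ := by
    refine eq_top_iff.2 fun a _ => ?_
    obtain ⟨s, hs, b, rfl⟩ := key n a
    simpa [hn] using hs
  calc Module.finrank K A = Module.finrank K (⊤ : Submodule K A) := finrank_top K A |>.symm
    _ ≤ ((Finset.range n).image (v ^ ·)).card := htop ▸ finrank_span_finset_le_card _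
    _ ≤ n := Finset.card_image_le.trans (Finset.card_range n).le

/-! ### Group algebras: augmentation, norm element, idempotents of normal subgroups. -/

namespace MonoidAlgebra

section

variable {K G : Type*} [Field K]

theorem finrank_eq_natCard [Finite G] : Module.finrank K (MonoidAlgebra K G) = Nat.card G := by
  have := Fintype.ofFinite G
  rw [(coeffLinearEquiv K : MonoidAlgebra K G ≃ₗ[K] G →₀ K).finrank_eq, Module.finrank_finsupp_self,
    Nat.card_eq_fintype_card]

theorem finite_of_finite [Finite K] [Finite G] : Finite (MonoidAlgebra K G) :=
  have : Finite (G →₀ K) := Finite.of_injective _ DFunLike.coe_injective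
  Finite.of_equiv _ coeffEquiv.symm

end

variable {K G H : Type*} [Field K] [Group G] [Group H]

/-- The augmentation of a group algebra, the sum of the coefficients. -/
noncomputable def augmentation (K G : Type*) [Field K] [Group G] : MonoidAlgebra K G →ₐ[K] K :=
  lift K K G 1

@[simp]
theorem augmentation_single (g : G) (r : K) : augmentation K G (single g r) = r := by
  simp [augmentation]

theorem augmentation_eq_sum [Fintype G] (x : MonoidAlgebra K G) :
    augmentation K G x = ∑ g, x.coeff g := by
  rw [augmentation, lift_apply, Finsupp.sum_fintype _ _ (by simp)]
  simp

@[simp]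
theorem augmentation_mapDomainAlgHom (φ : G →* H) (x : MonoidAlgebra K G) :
    augmentation K H (mapDomainAlgHom K K φ x) = augmentation K G x := by
  have : (augmentation K H).comp (mapDomainAlgHom K K φ) = augmentation K G := by
    ext; simp
  exact DFunLike.congr_fun this x

theorem belongsToBlock_trivial_iff {f : MonoidAlgebra K G} :
    BelongsToBlock (Representation.trivial K G K) f ↔ augmentation K G f = 1 := by
  have h : ∀ x, (Representation.trivial K G K).asAlgebraHom x
      = algebraMap K _ (augmentation K G x) := by
    intro x
    induction x using induction_linear with
    | zero => simp
    | add x y hx hy => simp [hx, hy]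
    | single g r => ext; simp
  rw [BelongsToBlock, h, ← map_one (algebraMap K (Module.End K K))]
  exact (FaithfulSMul.algebraMap_injective K _).eq_iff

theorem charP_of_field (p : ℕ) [CharP K p] : CharP (MonoidAlgebra K G) p :=
  charP_of_injective_ringHom (FaithfulSMul.algebraMap_injective K (MonoidAlgebra K G)) p

theorem mul_comm_of_group (hG : ∀ g h : G, g * h = h * g) (x y : MonoidAlgebra K G) :
    x * y = y * x := by
  induction x using induction_linear with
  | zero => simp
  | add x z hx hz => simp [add_mul, mul_add, hx, hz]
  | single g r =>
    induction y using induction_linear with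
    | zero => simp
    | add x z hx hz => simp [add_mul, mul_add, hx, hz]
    | single h s => simp [hG g h, mul_comm r s]

/-- The Frobenius power of exponent `p ^ s` on the group algebra of an abelian group of exponent
dividing `p ^ s`. -/
theorem pow_eq_algebraMap (p s : ℕ) [Fact p.Prime] [CharP K p] (hG : ∀ g h : G, g * h = h * g)
    (hs : ∀ g : G, g ^ p ^ s = 1) (x : MonoidAlgebra K G) :
    x ^ p ^ s = algebraMap K _ (augmentation K G x ^ p ^ s) := by
  have := charP_of_field (K := K) (G := G) p
  have hp : p ≠ 0 := (Fact.out : p.Prime).ne_zero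
  induction x using induction_linear with
  | zero => simp [zero_pow, hp]
  | add x y hx hy =>
    rw [add_pow_char_pow_of_commute _ _ (mul_comm_of_group hG x y), hx, hy, map_add,
      add_pow_char_pow, map_add]
  | single g r => rw [single_pow, hs, augmentation_single]; simp

/-- An idempotent equals its own `p ^ s`-th power, which is a scalar read off from the augmentation.
-/
theorem eq_one_of_isIdempotentElem (p s : ℕ) [Fact p.Prime] [CharP K p]
    (hG : ∀ g h : G, g * h = h * g) (hs : ∀ g : G, g ^ p ^ s = 1) {e : MonoidAlgebra K G}
    (he : IsIdempotentElem e) (h1 : augmentation K G e = 1) : e = 1 := by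
  have hp : p ^ s ≠ 0 := pow_ne_zero _ (Fact.out : p.Prime).ne_zero
  rw [← he.pow_eq hp, pow_eq_algebraMap p s hG hs, h1, one_pow, map_one]

theorem exists_eq_algebraMap_add_mul {g : G} (hg : ∀ h, h ∈ Submonoid.powers g)
    (x : MonoidAlgebra K G) :
    ∃ y, x = algebraMap K _ (augmentation K G x) + (single g 1 - 1) * y := by
  induction x using induction_linear with
  | zero => exact ⟨0, by simp⟩
  | add x y hx hy =>
    obtain ⟨a, ha⟩ := hx
    obtain ⟨b, hb⟩ := hy
    refine ⟨a + b, ?_⟩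
    conv_lhs => rw [ha, hb]
    rw [map_add, map_add, mul_add]
    abel
  | single h r =>
    obtain ⟨n, rfl⟩ := hg h
    -- The geometric sum comes from factoring `g ^ n - 1`.
    refine ⟨(∑ i ∈ Finset.range n, single g 1 ^ i) * algebraMap K _ r, ?_⟩
    rw [← mul_assoc, mul_geom_sum, augmentation_single, sub_mul, single_pow]
    simp

/-- The coefficients of `x` are constant on the left cosets of `⟨g⟩`, each of which has `p` elements
and so contributes `0`. -/
theorem augmentation_eq_zero_of_mul_single_eq (p : ℕ) [CharP K p] [Finite G] {g : G}
    (hg : orderOf g = p) {x : MonoidAlgebra K G} (hx : x * single g 1 = x) :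
    augmentation K G x = 0 := by
  have := Fintype.ofFinite G
  have h1 : ∀ h, x.coeff (h * g) = x.coeff h := by
    intro h
    conv_lhs => rw [← hx]
    rw [coeff_mul_single_mul, mul_one]
  have h2 : ∀ (k : Subgroup.zpowers g) h, x.coeff (h * k) = x.coeff h := by
    rintro ⟨k, hk⟩
    obtain ⟨n, rfl⟩ := (mem_powers_iff_mem_zpowers).2 hk
    dsimp only
    induction n with
    | zero => simp
    | succ n ih =>
      intro h
      rw [pow_succ, ← mul_assoc, h1]
      exact ih ((mem_powers_iff_mem_zpowers).1 ⟨n, rfl⟩) h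
  classical
  have hfin := Fintype.ofFinite (Subgroup.zpowers g)
  have hfinq := Fintype.ofFinite (G ⧸ Subgroup.zpowers g)
  rw [augmentation_eq_sum,
    ← (Subgroup.groupEquivQuotientProdSubgroup (s := Subgroup.zpowers g)).symm.sum_comp,
    Fintype.sum_prod_type]
  refine Finset.sum_eq_zero fun q _ => ?_
  have h3 : ∀ k : Subgroup.zpowers g,
      x.coeff (Subgroup.groupEquivQuotientProdSubgroup.symm (q, k)) = x.coeff q.out := by
    intro k
    set y := Subgroup.groupEquivQuotientProdSubgroup.symm (q, k) with hy
    have hq : (y : G ⧸ Subgroup.zpowers g) = q := by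
      have : (Subgroup.groupEquivQuotientProdSubgroup y).1 = q := by rw [hy, Equiv.apply_symm_apply]
      exact this
    obtain ⟨n, hn⟩ := QuotientGroup.mk_out_eq_mul (Subgroup.zpowers g) y
    rw [← hq, hn, h2]
  rw [Finset.sum_congr rfl fun k _ => h3 k, Finset.sum_const, Finset.card_univ,
    ← Nat.card_eq_fintype_card, Nat.card_zpowers, hg, nsmul_eq_mul, CharP.cast_eq_zero, zero_mul]

/-- The sum of all group elements. -/
noncomputable def normElement (K G : Type*) [Field K] [Group G] [Finite G] : MonoidAlgebra K G :=
  let := Fintype.ofFinite G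
  ∑ g : G, single g 1

theorem single_mul_normElement [Finite G] (h : G) (r : K) :
    single h r * normElement K G = r • normElement K G := by
  let := Fintype.ofFinite G
  rw [normElement, Finset.mul_sum, Finset.smul_sum, ← Equiv.sum_comp (Equiv.mulLeft h⁻¹)]
  simp

theorem mul_normElement [Finite G] (x : MonoidAlgebra K G) :
    x * normElement K G = augmentation K G x • normElement K G := by
  induction x using induction_linear with
  | zero => simp
  | add x y hx hy => simp [add_mul, add_smul, hx, hy]
  | single h r => rw [single_mul_normElement, augmentation_single]

theorem coeff_normElement [Finite G] (g : G) : (normElement K G).coeff g = 1 := by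
  classical
  let := Fintype.ofFinite G
  simp [normElement, Finsupp.single_apply]

theorem normElement_ne_zero [Finite G] : normElement K G ≠ 0 := fun h => by
  have := coeff_normElement (K := K) (1 : G)
  simp [h] at this

theorem normElement_mul_single [Finite G] (h : G) (r : K) :
    normElement K G * single h r = r • normElement K G := by
  let := Fintype.ofFinite G
  rw [normElement, Finset.sum_mul, Finset.smul_sum, ← Equiv.sum_comp (Equiv.mulRight h⁻¹)]
  simp

theorem normElement_mul [Finite G] (x : MonoidAlgebra K G) :
    normElement K G * x = augmentation K G x • normElement K G := by
  induction x using induction_linear with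
  | zero => simp
  | add x y hx hy => simp [mul_add, add_smul, hx, hy]
  | single h r => rw [normElement_mul_single, augmentation_single]

theorem eq_smul_normElement [Finite G] {x : MonoidAlgebra K G}
    (hx : ∀ g, x * single g 1 = x) : x = x.coeff 1 • normElement K G := by
  ext g
  rw [coeff_smul_apply, coeff_normElement, smul_eq_mul, mul_one]
  conv_lhs => rw [← hx g]
  have := coeff_mul_single_mul x 1 g 1
  rwa [one_mul, mul_one] at this

/-- A normal subgroup `N` of invertible order gives a central idempotent `e` of augmentation `1`
that is fixed by `N` and annihilates the kernel of `K[G] → K[G ⧸ N]`. -/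
theorem exists_central_idempotent_of_normal [Finite G] (N : Subgroup G) [N.Normal]
    (hN : (Nat.card N : K) ≠ 0) :
    ∃ e ∈ Subring.center (MonoidAlgebra K G), IsIdempotentElem e ∧ augmentation K G e = 1 ∧
      ∀ x, mapDomainAlgHom K K (QuotientGroup.mk' N) x = 0 → e * x = 0 := by
  classical
  have := Fintype.ofFinite G
  have := Fintype.ofFinite N
  set s : MonoidAlgebra K G := ∑ n : N, single (n : G) 1 with hs
  have hsN : ∀ n : N, s * single (n : G) 1 = s := by
    intro n
    rw [hs, Finset.sum_mul, ← Equiv.sum_comp (Equiv.mulRight n⁻¹)]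
    simp
  have hss : s * s = (Nat.card N : K) • s := by
    conv_lhs => rhs; rw [hs]
    rw [Finset.mul_sum, Finset.sum_congr rfl fun n _ => hsN n, Finset.sum_const, Finset.card_univ,
      ← Nat.card_eq_fintype_card, Nat.cast_smul_eq_nsmul]
  have hsc : s ∈ Subring.center (MonoidAlgebra K G) := by
    rw [Subring.mem_center_iff]
    intro x
    induction x using induction_linear with
    | zero => simp
    | add x y hx hy => simp [mul_add, add_mul, hx, hy]
    | single g r =>
      rw [hs, Finset.mul_sum, Finset.sum_mul, ← (MulAut.conjNormal g).toEquiv.sum_comp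
        (fun n : N => single (n : G) (1 : K) * single g r)]
      refine Finset.sum_congr rfl fun n _ => ?_
      simp [MulAut.conjNormal_apply]
  have haug : augmentation K G s = Nat.card N := by
    simp [hs, Nat.card_eq_fintype_card]
  have hcen : ∀ r : K, r • s ∈ Subring.center (MonoidAlgebra K G) := by
    intro r
    rw [Subring.mem_center_iff] at hsc ⊢
    intro x
    rw [mul_smul_comm, smul_mul_assoc, hsc]
  refine ⟨(Nat.card N : K)⁻¹ • s, hcen _, ?_, ?_, ?_⟩
  · rw [IsIdempotentElem, smul_mul_smul_comm, hss, smul_smul, mul_assoc, inv_mul_cancel₀ hN, mul_one]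
  · rw [map_smul, haug, smul_eq_mul, inv_mul_cancel₀ hN]
  · intro x hx
    -- As `s` absorbs `N`, each group element may be replaced by the chosen representative of its
    -- coset, so `s * x` depends only on the image of `x`.
    have hrep : s * x = s * mapDomainLinearMap K K (Quotient.out : G ⧸ N → G)
        (mapDomainAlgHom K K (QuotientGroup.mk' N) x) := by
      clear hx
      induction x using induction_linear with
      | zero => simp
      | add x y hx hy => rw [mul_add, hx, hy, map_add, map_add, mul_add]
      | single g r =>
        obtain ⟨n, hn⟩ := QuotientGroup.mk_out_eq_mul N g
        have h1 : s * single g r = s * single (g * n) r := by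
          obtain ⟨m, hm⟩ : ∃ m : N, g * n = m * g :=
            ⟨⟨g * n * g⁻¹, (inferInstance : N.Normal).conj_mem _ n.2 g⟩, by simp⟩
          have := congrArg (· * single g r) (hsN m)
          simpa [mul_assoc, hm] using this.symm
        rw [h1, ← hn]
        simp
    rw [smul_mul_assoc, hrep, hx, map_zero, mul_zero, smul_zero]

end MonoidAlgebra

/-! ### Corner rings of central idempotents. -/

section Corner

variable {R : Type*} [Ring R] {f : R}

/-- Multiplication by a central idempotent, as a ring homomorphism onto the corner ring. -/
def toCorner (hf : IsIdempotentElem f) (hc : f ∈ Subring.center R) : R →+* hf.Corner where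
  toFun x := ⟨f * x, (Subsemigroup.mem_corner_iff hf).2 ⟨by rw [← mul_assoc, hf.eq], by
    rw [mul_assoc, Subring.mem_center_iff.1 hc x, ← mul_assoc, hf.eq]⟩⟩
  map_one' := Subtype.ext (mul_one f)
  map_zero' := Subtype.ext (mul_zero f)
  map_add' x y := Subtype.ext (mul_add f x y)
  map_mul' x y := Subtype.ext <| by
    change f * (x * y) = f * x * (f * y)
    rw [mul_assoc, ← mul_assoc x, Subring.mem_center_iff.1 hc x, mul_assoc, ← mul_assoc f f, hf.eq]

variable (hf : IsIdempotentElem f) (hc : f ∈ Subring.center R)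

@[simp]
theorem coe_toCorner (x : R) : (toCorner hf hc x).1 = f * x := rfl

theorem mul_coe_corner (a : hf.Corner) : f * a.1 = a.1 :=
  ((Subsemigroup.mem_corner_iff hf).1 a.2).1

theorem coe_corner_mul (a : hf.Corner) : a.1 * f = a.1 :=
  ((Subsemigroup.mem_corner_iff hf).1 a.2).2

theorem toCorner_coe (a : hf.Corner) : toCorner hf hc a.1 = a :=
  Subtype.ext (mul_coe_corner hf a)

/-- A ring homomorphism mapping the idempotent `f` to `1` restricts to the corner ring of `f`. -/
def cornerLift {S : Type*} [Ring S] (φ : R →+* S) (h : φ f = 1) : hf.Corner →+* S where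
  toFun a := φ a.1
  map_one' := h
  map_zero' := map_zero φ
  map_add' a b := map_add φ a.1 b.1
  map_mul' a b := map_mul φ a.1 b.1

@[simp]
theorem cornerLift_apply {S : Type*} [Ring S] (φ : R →+* S) (h : φ f = 1) (a : hf.Corner) :
    cornerLift hf φ h a = φ a.1 := rfl

theorem cornerLift_toCorner {S : Type*} [Ring S] (φ : R →+* S) (h : φ f = 1) (x : R) :
    cornerLift hf φ h (toCorner hf hc x) = φ x := by
  rw [cornerLift_apply, coe_toCorner, map_mul, h, one_mul]

include hc in
theorem coe_mem_center_of_mem_center_corner {e : hf.Corner} (he : e ∈ Subring.center hf.Corner) :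
    e.1 ∈ Subring.center R := by
  rw [Subring.mem_center_iff] at he ⊢
  intro x
  have h := congrArg Subtype.val (he (toCorner hf hc x))
  change f * x * e.1 = e.1 * (f * x) at h
  rwa [← Subring.mem_center_iff.1 hc x, mul_assoc, mul_coe_corner,
    Subring.mem_center_iff.1 hc x, ← mul_assoc, coe_corner_mul] at h

/-- The corner ring of a block idempotent has no nontrivial central idempotents. -/
theorem IsBlockIdempotent.eq_zero_or_eq_one_of_corner (hb : IsBlockIdempotent f)
    (e : hb.idem.Corner) (he : e ∈ Subring.center hb.idem.Corner) (hi : IsIdempotentElem e) :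
    e = 0 ∨ e = 1 := by
  have hc := coe_mem_center_of_mem_center_corner hb.idem hb.mem_center he
  have hc' := coe_mem_center_of_mem_center_corner hb.idem hb.mem_center
    (Subring.sub_mem _ (Subring.one_mem _) he)
  rcases hb.primitive e.1 hc (1 - e).1 hc' (congrArg Subtype.val hi.eq)
    (congrArg Subtype.val hi.one_sub.eq)
    (congrArg Subtype.val (show e * (1 - e) = 0 by rw [mul_sub, mul_one, hi.eq, sub_self]))
    (congrArg Subtype.val (show 1 = e + (1 - e) by rw [add_sub_cancel])) with h | h
  · exact Or.inl (Subtype.ext h)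
  · exact Or.inr (sub_eq_zero.1 (show (1 : hb.idem.Corner) - e = 0 from Subtype.ext h)).symm

end Corner

/-! ### The principal block and the two implications. -/

section Block

open MonoidAlgebra

variable {K G : Type*} [Field K] [Group G]

/-- Primitivity kills one summand of `f = f * e + f * (1 - e)`; the first survives because its
augmentation is `1`. -/
theorem IsBlockIdempotent.mul_eq_self {f e : MonoidAlgebra K G} (hb : IsBlockIdempotent f)
    (h1 : augmentation K G f = 1) (hc : e ∈ Subring.center (MonoidAlgebra K G))
    (hi : IsIdempotentElem e) (he : augmentation K G e = 1) : f * e = f := by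
  have hcomm : ∀ x, x * f = f * x := Subring.mem_center_iff.1 hb.mem_center
  have hid : ∀ d : MonoidAlgebra K G, IsIdempotentElem d → IsIdempotentElem (f * d) := by
    intro d hd
    rw [IsIdempotentElem, mul_assoc, ← mul_assoc d, hcomm, mul_assoc, hd.eq, ← mul_assoc,
      hb.idem.eq]
  rcases hb.primitive (f * e) (Subring.mul_mem _ hb.mem_center hc) (f * (1 - e))
    (Subring.mul_mem _ hb.mem_center (Subring.sub_mem _ (Subring.one_mem _) hc)) (hid e hi)
    (hid _ hi.one_sub)
    (by rw [mul_assoc, ← mul_assoc e, hcomm, mul_assoc, mul_sub, mul_one, hi.eq]; simp)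
    (by rw [← mul_add, add_sub_cancel, mul_one]) with h | h
  · have := congrArg (augmentation K G) h
    simp [h1, he] at this
  · rw [mul_sub, mul_one, sub_eq_zero] at h
    exact h.symm

variable {f : MonoidAlgebra K G} (hb : IsBlockIdempotent f) (h1 : augmentation K G f = 1)

theorem mapDomainAlgHom_mk_surjective (N : Subgroup G) [N.Normal] :
    Function.Surjective (mapDomainAlgHom K K (QuotientGroup.mk' N)) := by
  intro y
  induction y using induction_linear with
  | zero => exact ⟨0, map_zero _⟩
  | add x y hx hy =>
    obtain ⟨a, rfl⟩ := hx
    obtain ⟨b, rfl⟩ := hy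
    exact ⟨a + b, map_add _ a b⟩
  | single q r =>
    obtain ⟨g, rfl⟩ := QuotientGroup.mk'_surjective N q
    exact ⟨single g r, by simp⟩

include h1 in
/-- If the line spanned by the norm element is a checkable right ideal of the principal block, then
the augmentation ideal of the block is generated by a nilpotent element. -/
theorem exists_isNilpotent_generator [Finite K] [Finite G]
    (h : ∀ I : Submodule hb.idem.Cornerᵐᵒᵖ hb.idem.Corner, IsCheckable I) :
    ∃ v : hb.idem.Corner, IsNilpotent v ∧ augmentation K G v.1 = 0 ∧
      ∀ a : hb.idem.Corner, augmentation K G a.1 = 0 → ∃ b, a = v * b := by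
  have := finite_of_finite (K := K) (G := G)
  have : Finite hb.idem.Corner := Subtype.finite
  let q := toCorner hb.idem hb.mem_center
  let ε : hb.idem.Corner →+* K := cornerLift hb.idem (augmentation K G : _ →+* K) h1
  have hεq : ∀ x, ε (q x) = augmentation K G x := fun x => cornerLift_toCorner _ _ _ _ x
  have hε : Function.Surjective ε := fun c => ⟨q (single 1 c), by
    rw [hεq, augmentation_single]⟩
  let I : Submodule hb.idem.Cornerᵐᵒᵖ hb.idem.Corner :=
    { carrier := {a | ∃ c : K, a.1 = c • normElement K G}
      add_mem' := by
        rintro a b ⟨c, hc⟩ ⟨d, hd⟩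
        refine ⟨c + d, ?_⟩
        rw [add_smul, ← hc, ← hd]
        rfl
      zero_mem' := ⟨0, by rw [zero_smul]; rfl⟩
      smul_mem' := by
        rintro r a ⟨c, hc⟩
        refine ⟨c * augmentation K G r.unop.1, ?_⟩
        change a.1 * r.unop.1 = _
        rw [hc, smul_mul_assoc, normElement_mul, smul_smul] }
  obtain ⟨v, hv⟩ := h I
  have hmem : ∀ a : hb.idem.Corner, v * a = 0 ↔ ∃ c : K, a.1 = c • normElement K G := by
    intro a
    change _ ↔ a ∈ I
    rw [hv]
    change _ ↔ ∀ c ∈ ({v} : Set hb.idem.Corner), c * a = 0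
    simp
  have hnorm : ∀ c : K, (q (c • normElement K G)).1 = c • normElement K G := by
    intro c
    rw [coe_toCorner, mul_smul_comm, mul_normElement, h1, one_smul]
  have hv0 : augmentation K G v.1 = 0 := by
    have h2 := congrArg Subtype.val ((hmem (q ((1 : K) • normElement K G))).2 ⟨1, hnorm 1⟩)
    change v.1 * (q ((1 : K) • normElement K G)).1 = 0 at h2
    rw [hnorm, one_smul, mul_normElement] at h2
    exact (smul_eq_zero.1 h2).resolve_right normElement_ne_zero
  have hgen : ∀ a, ε a = 0 → (∃ b, a = v * b) ∧ ∃ b, a = b * v := by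
    intro a
    refine ker_eq_mul_of_rightAnnihilator ε hε hv0 ?_ ?_
    · refine Nat.card_le_card_of_surjective
        (fun c : K => ⟨q (c • normElement K G), (hmem _).2 ⟨c, hnorm c⟩⟩) ?_
      rintro ⟨a, ha⟩
      obtain ⟨c, hc⟩ := (hmem a).1 ha
      exact ⟨c, Subtype.ext (Subtype.ext ((hnorm c).trans hc.symm))⟩
    -- The elements `f * g - f` have augmentation `0`; being killed by `a` on the left, they make
    -- `a` invariant under right multiplication by `G`, hence a multiple of the norm element.
    · intro a ha
      refine (hmem a).2 ⟨_, eq_smul_normElement fun g => ?_⟩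
      have h2 := congrArg Subtype.val (ha (q (single g 1) - 1) (by
        rw [map_sub, map_one, hεq, augmentation_single, sub_self]))
      change a.1 * (f * single g 1 - f) = 0 at h2
      rwa [mul_sub, ← mul_assoc, coe_corner_mul, sub_eq_zero] at h2
  refine ⟨v, ?_, hv0, fun a ha => (hgen a ha).1⟩
  refine isNilpotent_of_normalizing hb.eq_zero_or_eq_one_of_corner
    (fun a => (hgen (v * a) ?_).2) (fun a => (hgen (a * v) ?_).1) fun hu => ?_
  · rw [map_mul, show ε v = 0 from hv0, zero_mul]
  · rw [map_mul, show ε v = 0 from hv0, mul_zero]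
  · exact (hu.map ε).ne_zero hv0

include h1 in
/-- A principal block with only checkable right ideals belongs to a `p`-nilpotent group with cyclic
Sylow `p`-subgroups. -/
theorem isPNilpotent_and_isCyclic_sylow [Finite K] [Finite G] (p : ℕ) [Fact p.Prime] [CharP K p]
    (h : ∀ I : Submodule hb.idem.Cornerᵐᵒᵖ hb.idem.Corner, IsCheckable I) :
    IsPNilpotent p G ∧ ∃ P : Sylow p G, IsCyclic P := by
  obtain ⟨v, hv, hv0, hgen⟩ := exists_isNilpotent_generator hb h1 h
  let q := toCorner hb.idem hb.mem_center
  let ε : hb.idem.Corner →+* K := cornerLift hb.idem (augmentation K G : _ →+* K) h1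
  have hεq : ∀ x, ε (q x) = augmentation K G x := fun x => cornerLift_toCorner _ _ _ _ x
  have hdec : ∀ a : hb.idem.Corner, ∃ b, a = q (algebraMap K _ (ε a)) + v * b := by
    intro a
    obtain ⟨b, hb'⟩ := hgen (a - q (algebraMap K _ (ε a))) (by
      change ε _ = 0
      rw [map_sub, hεq]
      simp)
    exact ⟨b, by rw [← hb', add_sub_cancel]⟩
  have hcomm : ∀ a b : hb.idem.Corner, a * b = b * a := by
    refine mul_comm_of_center_add_nilpotent hv fun a => ?_
    obtain ⟨b, hb'⟩ := hdec a
    refine ⟨_, Subring.mem_center_iff.2 fun c => ?_, b, hb'⟩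
    rw [← toCorner_coe hb.idem hb.mem_center c]
    change q _ * q _ = q _ * q _
    rw [← map_mul, ← map_mul, Algebra.commutes]
  have hnt : Nontrivial hb.idem.Corner := ε.domain_nontrivial
  have hchar : CharP hb.idem.Corner p :=
    charP_of_injective_ringHom (q.comp (algebraMap K (MonoidAlgebra K G))).injective p
  let φ : G →* hb.idem.Corner := (q : MonoidAlgebra K G →* hb.idem.Corner).comp (of K G)
  let N := φ.ker
  have hφ : ∀ g, φ g = q (single g 1) := fun g => rfl
  have hN : ¬ p ∣ Nat.card N := by
    intro hdvd
    obtain ⟨g, hg⟩ := exists_prime_orderOf_dvd_card' p hdvd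
    -- An element of order `p` in the kernel fixes `f`, forcing the augmentation of `f` to be `0`.
    have h2 : φ g = 1 := g.2
    have h3 : f * single (g : G) 1 = f := congrArg Subtype.val h2
    have h4 := augmentation_eq_zero_of_mul_single_eq p (by rwa [Subgroup.orderOf_coe]) h3
    rw [h1] at h4
    exact one_ne_zero h4
  have hQ : IsPGroup p (G ⧸ N) := by
    intro x
    obtain ⟨g, rfl⟩ := QuotientGroup.mk_surjective x
    obtain ⟨n, hn⟩ := hv
    refine ⟨n, ?_⟩
    rw [← QuotientGroup.mk_pow, QuotientGroup.eq_one_iff, MonoidHom.mem_ker, map_pow]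
    obtain ⟨b, hb'⟩ := hgen (φ g - 1) (by
      change ε _ = 0
      rw [map_sub, map_one, hφ, hεq, augmentation_single, sub_self])
    -- Here `v ^ n = 0` and `n < p ^ n`; by Frobenius this power is also `φ g ^ p ^ n - 1`.
    have h2 : (φ g - 1) ^ p ^ n = 0 := by
      rw [hb', (show Commute v b from hcomm v b).mul_pow,
        pow_eq_zero_of_le (Nat.lt_pow_self (Fact.out : p.Prime).one_lt).le hn, zero_mul]
    rwa [sub_pow_char_pow_of_commute _ _ (hcomm _ _), one_pow, sub_eq_zero] at h2
  have hQcomm : ∀ x y : G ⧸ N, x * y = y * x := by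
    intro x y
    obtain ⟨g, rfl⟩ := QuotientGroup.mk_surjective x
    obtain ⟨k, rfl⟩ := QuotientGroup.mk_surjective y
    rw [← QuotientGroup.mk_mul, ← QuotientGroup.mk_mul, QuotientGroup.eq, MonoidHom.mem_ker,
      map_mul, map_mul φ k, hcomm (φ k), ← map_mul φ g, ← map_mul, inv_mul_cancel, map_one]
  have hQcyc : IsCyclic (G ⧸ N) := by
    obtain ⟨n, hn⟩ := hQ.exists_card_eq
    obtain ⟨s, -, hs⟩ := (Nat.dvd_prime_pow Fact.out).1 (hn ▸ Group.exponent_dvd_nat_card)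
    have hs1 : ∀ x : G ⧸ N, x ^ p ^ s = 1 := fun x => hs ▸ Monoid.pow_exponent_eq_one x
    have hp : p ^ s ≠ 0 := pow_ne_zero _ (Fact.out : p.Prime).ne_zero
    let π := mapDomainAlgHom K K (QuotientGroup.mk' N)
    have hπf : π f = 1 := eq_one_of_isIdempotentElem p s hQcomm hs1 (hb.idem.map π) (by
      rw [augmentation_mapDomainAlgHom, h1])
    have hπv : π v.1 ^ p ^ s = 0 := by
      rw [pow_eq_algebraMap p s hQcomm hs1, augmentation_mapDomainAlgHom, hv0, zero_pow hp,
        map_zero]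
    -- The decomposition `B = K + vB` descends to `K[G ⧸ N]`, with `π v` nilpotent of index at most
    -- the exponent `p ^ s`. So the order is at most the exponent.
    have hle : Module.finrank K (MonoidAlgebra K (G ⧸ N)) ≤ p ^ s := by
      refine finrank_le_of_pow_eq_zero hπv fun y => ?_
      obtain ⟨x, rfl⟩ := mapDomainAlgHom_mk_surjective N y
      obtain ⟨b, hb'⟩ := hdec (q x)
      refine ⟨ε (q x), π b.1, ?_⟩
      have h2 := congrArg (fun a => π a.1) hb'
      change π (f * x) = π (f * algebraMap K _ (ε (q x)) + v.1 * b.1) at h2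
      rwa [map_mul, map_add, map_mul, map_mul, hπf, one_mul, one_mul, AlgHom.commutes] at h2
    rw [finrank_eq_natCard, ← hs] at hle
    let : CommGroup (G ⧸ N) := { (inferInstance : Group (G ⧸ N)) with mul_comm := hQcomm }
    exact IsCyclic.of_exponent_eq_card
      (le_antisymm (Nat.le_of_dvd Nat.card_pos Group.exponent_dvd_nat_card) hle)
  refine ⟨⟨N, inferInstance, hN, hQ⟩, default, ?_⟩
  -- Coprime orders make the Sylow subgroup meet `N` trivially.
  refine isCyclic_of_injective ((QuotientGroup.mk' N).comp (default : Sylow p G).1.subtype) ?_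
  rw [injective_iff_map_eq_one]
  intro x hx
  have hxN : (x : G) ∈ N := (QuotientGroup.eq_one_iff _).1 hx
  obtain ⟨k, hk⟩ := (default : Sylow p G).2.exists_orderOf_dvd_pow x
  have hcop : (p ^ k).Coprime (Nat.card N) :=
    ((Fact.out : p.Prime).coprime_iff_not_dvd.2 hN).pow_left k
  rw [← orderOf_eq_one_iff]
  refine Nat.eq_one_of_dvd_coprimes hcop hk ?_
  rw [← Subgroup.orderOf_coe]
  exact Subgroup.orderOf_dvd_natCard N hxN

include h1 in
/-- The principal block of a `p`-nilpotent group with cyclic Sylow `p`-subgroups has only checkable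
right ideals. -/
theorem isCheckable_of_isPNilpotent [Finite G] (p : ℕ) [Fact p.Prime] [CharP K p]
    (hG : IsPNilpotent p G) (P : Sylow p G) [IsCyclic P]
    (I : Submodule hb.idem.Cornerᵐᵒᵖ hb.idem.Corner) : IsCheckable I := by
  obtain ⟨N, _, hN, hQ⟩ := hG
  have hQcyc : IsCyclic (G ⧸ N) := by
    have hsurj := QuotientGroup.mk'_surjective N
    -- The image of `P` is a Sylow subgroup of a `p`-group, hence the whole quotient.
    have htop : (P.mapSurjective hsurj : Subgroup (G ⧸ N)) = ⊤ :=
      ((P.mapSurjective hsurj).is_maximal' (hQ.to_subgroup ⊤) le_top).symm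
    refine isCyclic_of_surjective ((QuotientGroup.mk' N).comp P.1.subtype) fun x => ?_
    have hx : x ∈ (P.mapSurjective hsurj : Subgroup (G ⧸ N)) := htop ▸ Subgroup.mem_top x
    obtain ⟨y, hy, rfl⟩ := hx
    exact ⟨⟨y, hy⟩, rfl⟩
  have hQcomm : ∀ x y : G ⧸ N, x * y = y * x := (IsCyclic.commGroup (α := G ⧸ N)).mul_comm
  obtain ⟨g, hg⟩ := IsCyclic.exists_monoid_generator (α := G ⧸ N)
  obtain ⟨s, hs⟩ := hQ.exists_card_eq
  have hs1 : ∀ x : G ⧸ N, x ^ p ^ s = 1 := fun x => hs ▸ pow_card_eq_one'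
  have hp : p ^ s ≠ 0 := pow_ne_zero _ (Fact.out : p.Prime).ne_zero
  let π := mapDomainAlgHom K K (QuotientGroup.mk' N)
  have hπf : π f = 1 := eq_one_of_isIdempotentElem p s hQcomm hs1 (hb.idem.map π) (by
    rw [augmentation_mapDomainAlgHom, h1])
  obtain ⟨e, hec, hei, he1, heπ⟩ :=
    exists_central_idempotent_of_normal (K := K) N (by rwa [Ne, CharP.cast_eq_zero_iff K p])
  have hfe := hb.mul_eq_self h1 hec hei he1
  let ψ : hb.idem.Corner →+* MonoidAlgebra K (G ⧸ N) := cornerLift hb.idem (π : _ →+* _) hπf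
  -- Injectivity: `f = f * e`, and `e` kills everything in the kernel of `π`.
  have hψ : Function.Bijective ψ := by
    constructor
    · rw [injective_iff_map_eq_zero]
      intro a ha
      refine Subtype.ext ?_
      change a.1 = 0
      calc a.1 = f * e * a.1 := (mul_coe_corner hb.idem a).symm.trans (congrArg (· * a.1) hfe.symm)
        _ = 0 := by rw [mul_assoc, heπ a.1 ha, mul_zero]
    · intro y
      obtain ⟨x, rfl⟩ := mapDomainAlgHom_mk_surjective N y
      exact ⟨toCorner hb.idem hb.mem_center x, cornerLift_toCorner _ _ _ _ x⟩
  let E := RingEquiv.ofBijective ψ hψ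
  refine isCheckable_of_isUnit_or_dvd (v := E.symm (single g 1 - 1)) ?_ (fun a => ?_) I
  · refine IsNilpotent.map ⟨p ^ s, ?_⟩ E.symm
    rw [pow_eq_algebraMap p s hQcomm hs1]
    simp [zero_pow hp]
  · obtain ⟨y, hy⟩ := exists_eq_algebraMap_add_mul hg (E a)
    by_cases h0 : augmentation K _ (E a) = 0
    · right
      refine ⟨E.symm y, E.injective ?_⟩
      rw [hy, h0, map_mul, E.apply_symm_apply, E.apply_symm_apply, map_zero, zero_add]
    · left
      -- The `p ^ s`-th power of an element of nonzero augmentation is a nonzero scalar.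
      rw [← MulEquiv.isUnit_map E, ← isUnit_pow_iff hp, pow_eq_algebraMap p s hQcomm hs1]
      exact (IsUnit.mk0 _ (pow_ne_zero _ h0)).map _

end Block

theorem mainTheorem3 (K G : Type*) [Field K] [Finite K] [Group G] [Finite G]
    (p : ℕ) [CharP K p] :
    (∀ I : Submodule (PrincipalBlock K G)ᵐᵒᵖ (PrincipalBlock K G), IsCheckable I) ↔
      (IsPNilpotent p G ∧ ∃ P : Sylow p G, IsCyclic P) := by
  have : Fact p.Prime := ⟨CharP.char_is_prime K p⟩
  have h1 := MonoidAlgebra.belongsToBlock_trivial_iff.1 (principalBlockIdempotent_spec K G).2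
  constructor
  · exact isPNilpotent_and_isCyclic_sylow (principalBlockIdempotent_spec K G).1 h1 p
  · rintro ⟨hG, P, hP⟩
    exact isCheckable_of_isPNilpotent (principalBlockIdempotent_spec K G).1 h1 p hG P
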